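/- Let $\mathcal H$ be a complex Hilbert space. For a bounded self-adjoint operator $A$ on $\mathcal H$, a bounded Borel function $f:\sigma(A)\to\mathbb R$ and a Borel set $\Delta\subseteq\sigma(A)$, let $f(A)=\int_{\sigma(A)} f\,dE^A$ and let $E[A\in\Delta]=\chi_\Delta(A)$ be the spectral projector. Let $\mathcal O$ be the category whose objects are the bounded self-adjoint operators on $\mathcal H$, with exactly one morphism $B\to A$, denoted $f$, if $B=f(A)$ for some bounded Borel function $f:\sigma(A)\to\mathbb R$, and none otherwise. For such a morphism $f:B\to A$ put $$E[B\in f(\Delta)]:=\inf\{E[B\in K]\;:\;K\subseteq\sigma(B)\text{ Borel},\ E[A\in\Delta]\le E[B\in K]\},$$ the infimum being taken in the lattice of projectors on $\mathcal H$. For a projector $P$ and a density matrix $\rho$ (a positive operator with $\operatorname{tr}\rho=1$) define sieves on $A$ in $\mathcal O$ by $$\nu^P(A\in\Delta)=\{f:B\to A\mid P\le E[B\in f(\Delta)]\},\qquad \nu^\rho(A\in\Delta)=\{f:B\to A\mid \operatorname{tr}(\rho\,E[B\in f(\Delta)])=1\}.$$ **Theorem.** Let $P$ be a projector on $\mathcal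 H$ whose range has finite dimension $n\ge 1$. Then $\rho^P:=\frac1n P$ is a density matrix, and for every bounded self-adjoint operator $A$ and every Borel set $\Delta\subseteq\sigma(A)$, $$\nu^P(A\in\Delta)=\nu^{\rho^P}(A\in\Delta).$$ -/

import Mathlib

namespace QuantumValuation

section

set_option linter.unusedSectionVars false

open MeasureTheory
open scoped InnerProductSpace

variable {H : Type*} [NormedAddCommGroup H] [InnerProductSpace ℂ H] [CompleteSpace H]

/-- A bounded physical quantity: a bounded self-adjoint operator on `H`. -/
structure Observable (H : Type*) [NormedAddCommGroup H] [InnerProductSpace ℂ H]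
    [CompleteSpace H] where
  op : H →L[ℂ] H
  isSelfAdjoint : IsSelfAdjoint op

/-- Bounded Borel functions on a measurable space. -/
structure IsBddBorel {X : Type*} [MeasurableSpace X] (f : X → ℝ) : Prop where
  measurable : Measurable f
  bounded : ∃ C : ℝ, ∀ x, |f x| ≤ C

theorem IsBddBorel.memLp {X : Type*} [MeasurableSpace X] {f : X → ℝ} (hf : IsBddBorel f)
    (μ : Measure X) [IsFiniteMeasure μ] (p : ENNReal) : MemLp f p μ := by
  obtain ⟨C, hC⟩ := hf.bounded
  exact MemLp.of_bound hf.measurable.aestronglyMeasurable C (Filter.Eventually.of_forall hC)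

theorem IsBddBorel.integrable {X : Type*} [MeasurableSpace X] {f : X → ℝ} (hf : IsBddBorel f)
    (μ : Measure X) [IsFiniteMeasure μ] : Integrable f μ :=
  memLp_one_iff_integrable.1 (hf.memLp μ 1)

theorem isBddBorel_cont {X : Type*} [MeasurableSpace X] [TopologicalSpace X] [BorelSpace X]
    [CompactSpace X] (g : C(X, ℝ)) : IsBddBorel g :=
  ⟨g.continuous.measurable, ‖g‖, fun x => g.norm_coe_le_norm x⟩

theorem IsBddBorel.sub {X : Type*} [MeasurableSpace X] {f g : X → ℝ} (hf : IsBddBorel f)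
    (hg : IsBddBorel g) : IsBddBorel (fun x => f x - g x) := by
  obtain ⟨C, hC⟩ := hf.bounded
  obtain ⟨D, hD⟩ := hg.bounded
  exact ⟨hf.measurable.sub hg.measurable, C + D,
    fun x => (abs_sub _ _).trans (add_le_add (hC x) (hD x))⟩

theorem IsBddBorel.mul {X : Type*} [MeasurableSpace X] {f g : X → ℝ} (hf : IsBddBorel f)
    (hg : IsBddBorel g) : IsBddBorel (fun x => f x * g x) := by
  obtain ⟨C, hC⟩ := hf.bounded
  obtain ⟨D, hD⟩ := hg.bounded
  refine ⟨hf.measurable.mul hg.measurable, C * D, fun x => ?_⟩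
  rw [abs_mul]
  exact mul_le_mul (hC x) (hD x) (abs_nonneg _) ((abs_nonneg _).trans (hC x))

theorem IsBddBorel.pow {X : Type*} [MeasurableSpace X] {f : X → ℝ} (hf : IsBddBorel f) (k : ℕ) :
    IsBddBorel (fun x => f x ^ k) := by
  obtain ⟨C, hC⟩ := hf.bounded
  refine ⟨hf.measurable.pow_const k, C ^ k, fun x => ?_⟩
  rw [abs_pow]
  exact pow_le_pow_left₀ (abs_nonneg _) (hC x) k

theorem integral_sub_sq {X : Type*} [MeasurableSpace X] {f g : X → ℝ} (hf : IsBddBorel f)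
    (hg : IsBddBorel g) (μ : Measure X) [IsFiniteMeasure μ] :
    ∫ x, (f x - g x) ^ 2 ∂μ = ∫ x, f x ^ 2 ∂μ - 2 * ∫ x, f x * g x ∂μ + ∫ x, g x ^ 2 ∂μ := by
  have hi1 : Integrable (fun x => f x ^ 2) μ := by
    simpa [sq] using (hf.mul hf).integrable μ
  have hi2 : Integrable (fun x => g x ^ 2) μ := by
    simpa [sq] using (hg.mul hg).integrable μ
  have hi3 := ((hf.mul hg).integrable μ).const_mul 2
  have hi4 : Integrable (fun x => f x ^ 2 - 2 * (f x * g x)) μ := hi1.sub hi3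
  rw [← integral_const_mul, ← integral_sub hi1 hi3, ← integral_add hi4 hi2]
  congr 1
  ext x
  ring

theorem exists_cont_approx {X : Type*} [MeasurableSpace X] [TopologicalSpace X] [BorelSpace X]
    [CompactSpace X] [T4Space X] {f : X → ℝ} (hf : IsBddBorel f) (μ : Measure X)
    [IsFiniteMeasure μ] [μ.WeaklyRegular] {ε : ℝ} (hε : 0 < ε) :
    ∃ g : C(X, ℝ), ∫ x, (f x - g x) ^ 2 ∂μ ≤ ε := by
  obtain ⟨g, hg, -⟩ := MemLp.exists_boundedContinuous_integral_rpow_sub_le (p := 2) (by norm_num)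
    (hf.memLp μ (ENNReal.ofReal 2)) hε
  refine ⟨g.toContinuousMap, ?_⟩
  refine le_of_eq_of_le (integral_congr_ae (Filter.Eventually.of_forall fun x => ?_)) hg
  simp

theorem integral_sq_sub_le {X : Type*} [MeasurableSpace X] {f g h : X → ℝ} (hf : IsBddBorel f)
    (hg : IsBddBorel g) (hh : IsBddBorel h) (μ : Measure X) [IsFiniteMeasure μ] :
    Real.sqrt (∫ x, (f x - h x) ^ 2 ∂μ) ≤
      Real.sqrt (∫ x, (f x - g x) ^ 2 ∂μ) + Real.sqrt (∫ x, (g x - h x) ^ 2 ∂μ) := by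
  have key : ∀ {u v : X → ℝ} (hu : IsBddBorel u) (hv : IsBddBorel v),
      Real.sqrt (∫ x, (u x - v x) ^ 2 ∂μ) =
        dist ((hu.memLp μ 2).toLp u) ((hv.memLp μ 2).toLp v) := by
    intro u v hu hv
    rw [dist_eq_norm, ← MemLp.toLp_sub, Lp.norm_toLp,
      (hu.memLp μ 2 |>.sub (hv.memLp μ 2)).eLpNorm_eq_integral_rpow_norm (by norm_num) (by norm_num),
      ENNReal.toReal_ofReal (by positivity), Real.sqrt_eq_rpow]
    simp
  rw [key hf hh, key hf hg, key hg hh]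
  exact dist_triangle _ _ _

namespace Observable

/-- The (real) spectrum `σ(A)`. -/
abbrev spec (A : Observable H) : Set ℝ := spectrum ℝ A.op

/-- The operator `g(A)` for a continuous function `g` on `σ(A)`. -/
noncomputable def contFun (A : Observable H) (g : C(A.spec, ℝ)) : H →L[ℂ] H :=
  cfcHom A.isSelfAdjoint g

/-- The positive functional `g ↦ ⟨ψ, g(A) ψ⟩` on continuous functions on `σ(A)`. -/
noncomputable def stateFunctional (A : Observable H) (ψ : H) :
    CompactlySupportedContinuousMap A.spec ℝ →ₚ[ℝ] ℝ :=
  PositiveLinearMap.mk₀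
    { toFun := fun g => (⟪ψ, A.contFun g.toContinuousMap ψ⟫_ℂ).re
      map_add' := fun g h => by
        have : (g + h).toContinuousMap = g.toContinuousMap + h.toContinuousMap := rfl
        simp [contFun, this, map_add]
      map_smul' := fun c g => by
        have : (c • g).toContinuousMap = c • g.toContinuousMap := rfl
        have h2 : A.contFun (c • g.toContinuousMap) = c • A.contFun g.toContinuousMap :=
          map_smul (cfcHom A.isSelfAdjoint) c g.toContinuousMap
        rw [this, h2, _root_.smul_apply, inner_smul_right_eq_smul]
        simp }
    (fun g hg => by
      have h1 : 0 ≤ A.contFun g.toContinuousMap := by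
        have := cfcHom_nonneg_iff A.isSelfAdjoint (f := g.toContinuousMap)
        exact this.2 hg
      exact ((ContinuousLinearMap.nonneg_iff_isPositive _).1 h1).re_inner_nonneg_right ψ)

/-- The spectral measure `Δ ↦ ⟨ψ, E[A ∈ Δ] ψ⟩` of `A` at the vector `ψ`, a Borel measure
on `σ(A)`: the measure that represents the functional `g ↦ ⟨ψ, g(A) ψ⟩`. -/
noncomputable def specMeasure (A : Observable H) (ψ : H) : Measure A.spec :=
  RealRMK.rieszMeasure (A.stateFunctional ψ)

instance (A : Observable H) (ψ : H) : (A.specMeasure ψ).Regular := by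
  unfold specMeasure; infer_instance

theorem contFun_isSelfAdjoint (A : Observable H) (g : C(A.spec, ℝ)) :
    IsSelfAdjoint (A.contFun g) := cfcHom_predicate A.isSelfAdjoint g

theorem contFun_symm (A : Observable H) (g : C(A.spec, ℝ)) (φ ψ : H) :
    ⟪A.contFun g φ, ψ⟫_ℂ = ⟪φ, A.contFun g ψ⟫_ℂ :=
  (ContinuousLinearMap.isSelfAdjoint_iff_isSymmetric.1 (A.contFun_isSelfAdjoint g)) φ ψ

theorem integral_specMeasure (A : Observable H) (ψ : H) (g : C(A.spec, ℝ)) :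
    ∫ x, g x ∂(A.specMeasure ψ) = (⟪ψ, A.contFun g ψ⟫_ℂ).re :=
  RealRMK.integral_rieszMeasure (A.stateFunctional ψ)
    (CompactlySupportedContinuousMap.continuousMapEquiv g)

theorem specMeasure_univ (A : Observable H) (ψ : H) :
    (A.specMeasure ψ).real Set.univ = ‖ψ‖ ^ 2 := by
  have h := A.integral_specMeasure ψ 1
  have h1 : A.contFun 1 = 1 := map_one (cfcHom A.isSelfAdjoint)
  rw [h1] at h
  simpa [inner_self_eq_norm_sq_to_K, ← Complex.ofReal_pow] using h

theorem norm_contFun_sq (A : Observable H) (ψ : H) (g : C(A.spec, ℝ)) :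
    ‖A.contFun g ψ‖ ^ 2 = ∫ x, g x ^ 2 ∂(A.specMeasure ψ) := by
  have h := A.integral_specMeasure ψ (g * g)
  have h1 : A.contFun (g * g) = A.contFun g * A.contFun g :=
    map_mul (cfcHom A.isSelfAdjoint) g g
  rw [h1, mul_apply_eq_comp, ← contFun_symm, inner_self_eq_norm_sq_to_K] at h
  simpa [sq, ← Complex.ofReal_mul] using h.symm

theorem contFun_sub (A : Observable H) (g h : C(A.spec, ℝ)) :
    A.contFun (g - h) = A.contFun g - A.contFun h := map_sub (cfcHom A.isSelfAdjoint) g h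

/-- The `L²(μ)` distance. -/
noncomputable def l2Dist {X : Type*} [MeasurableSpace X] (μ : Measure X) (f g : X → ℝ) : ℝ :=
  Real.sqrt (∫ x, (f x - g x) ^ 2 ∂μ)

theorem l2Dist_comm {X : Type*} [MeasurableSpace X] (μ : Measure X) (f g : X → ℝ) :
    l2Dist μ f g = l2Dist μ g f := by
  unfold l2Dist
  congr 2
  ext x
  ring

theorem l2Dist_sq {X : Type*} [MeasurableSpace X] (μ : Measure X) (f g : X → ℝ) :
    l2Dist μ f g ^ 2 = ∫ x, (f x - g x) ^ 2 ∂μ :=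
  Real.sq_sqrt (integral_nonneg fun _ => sq_nonneg _)

theorem norm_contFun_sub (A : Observable H) (ψ : H) (g h : C(A.spec, ℝ)) :
    ‖A.contFun g ψ - A.contFun h ψ‖ = l2Dist (A.specMeasure ψ) g h := by
  rw [← sub_apply, ← contFun_sub, l2Dist, ← Real.sqrt_sq (norm_nonneg _),
    norm_contFun_sq]
  rfl

theorem exists_vec (A : Observable H) {f : A.spec → ℝ} (hf : IsBddBorel f) (ψ : H) :
    ∃ v : H, ∀ g : C(A.spec, ℝ),
      ‖v - A.contFun g ψ‖ = l2Dist (A.specMeasure ψ) f g := by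
  set μ := A.specMeasure ψ with hμ
  have hex : ∀ n : ℕ, ∃ g : C(A.spec, ℝ), l2Dist μ f g ≤ 1 / ((n : ℝ) + 1) := by
    intro n
    have hn : (0 : ℝ) < 1 / ((n : ℝ) + 1) := Nat.one_div_pos_of_nat
    obtain ⟨g, hg⟩ := exists_cont_approx hf μ (pow_pos hn 2)
    exact ⟨g, (Real.sqrt_le_sqrt hg).trans_eq (Real.sqrt_sq hn.le)⟩
  choose g hg using hex
  have hlim : Filter.Tendsto (fun n : ℕ => 1 / ((n : ℝ) + 1)) Filter.atTop (nhds 0) :=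
    tendsto_one_div_add_atTop_nhds_zero_nat
  have hD : Filter.Tendsto (fun n => l2Dist μ f (g n)) Filter.atTop (nhds 0) :=
    squeeze_zero (fun n => Real.sqrt_nonneg _) hg hlim
  have hc : CauchySeq fun n => A.contFun (g n) ψ := by
    refine cauchySeq_of_le_tendsto_0 (fun n : ℕ => 2 * (1 / ((n : ℝ) + 1))) ?_ ?_
    · intro n m N hn hm
      rw [dist_eq_norm, norm_contFun_sub]
      refine (integral_sq_sub_le (isBddBorel_cont (g n)) hf (isBddBorel_cont (g m)) μ).trans ?_
      change l2Dist μ (g n) f + l2Dist μ f (g m) ≤ _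
      rw [l2Dist_comm]
      have := hg n
      have := hg m
      have h1 := Nat.one_div_le_one_div (α := ℝ) hn
      have h2 := Nat.one_div_le_one_div (α := ℝ) hm
      linarith
    · simpa using hlim.const_mul 2
  obtain ⟨v, hv⟩ := cauchySeq_tendsto_of_complete hc
  refine ⟨v, fun h => ?_⟩
  have h1 : Filter.Tendsto (fun n => ‖A.contFun (g n) ψ - A.contFun h ψ‖) Filter.atTop
      (nhds ‖v - A.contFun h ψ‖) := (hv.sub_const _).norm
  refine tendsto_nhds_unique h1 ?_
  simp_rw [norm_contFun_sub]
  rw [tendsto_iff_dist_tendsto_zero]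
  refine squeeze_zero (fun n => dist_nonneg) (fun n => ?_) hD
  rw [Real.dist_eq, abs_le]
  have a1 := integral_sq_sub_le (isBddBorel_cont (g n)) hf (isBddBorel_cont h) μ
  have a2 := integral_sq_sub_le hf (isBddBorel_cont (g n)) (isBddBorel_cont h) μ
  change l2Dist μ (g n) h ≤ l2Dist μ (g n) f + l2Dist μ f h at a1
  change l2Dist μ f h ≤ l2Dist μ f (g n) + l2Dist μ (g n) h at a2
  rw [l2Dist_comm μ (g n) f] at a1
  constructor <;> linarith

theorem l2Dist_mono {X : Type*} [MeasurableSpace X] {f g : X → ℝ} (hf : IsBddBorel f)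
    (hg : IsBddBorel g) {μ ν : Measure X} [IsFiniteMeasure ν] (h : μ ≤ ν) :
    l2Dist μ f g ≤ l2Dist ν f g := by
  refine Real.sqrt_le_sqrt (integral_mono_measure h
    (Filter.Eventually.of_forall fun x => sq_nonneg _) ?_)
  have := ((hf.sub hg).mul (hf.sub hg)).integrable ν
  simpa [sq] using this

theorem exists_cont_approx_three (A : Observable H) {f : A.spec → ℝ} (hf : IsBddBorel f)
    (ψ₁ ψ₂ ψ₃ : H) {ε : ℝ} (hε : 0 < ε) :
    ∃ g : C(A.spec, ℝ), l2Dist (A.specMeasure ψ₁) f g ≤ ε ∧ l2Dist (A.specMeasure ψ₂) f g ≤ ε ∧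
      l2Dist (A.specMeasure ψ₃) f g ≤ ε := by
  obtain ⟨g, hg⟩ := exists_cont_approx hf
    (A.specMeasure ψ₁ + A.specMeasure ψ₂ + A.specMeasure ψ₃) (pow_pos hε 2)
  have hg' := (Real.sqrt_le_sqrt hg).trans_eq (Real.sqrt_sq hε.le)
  refine ⟨g, ?_, ?_, ?_⟩ <;> refine (l2Dist_mono hf (isBddBorel_cont g) ?_).trans hg'
  · rw [add_assoc]; exact Measure.le_add_right le_rfl
  · exact Measure.le_add_right (Measure.le_add_left le_rfl)
  · exact Measure.le_add_left le_rfl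

theorem exists_op_aux (A : Observable H) {f : A.spec → ℝ} (hf : IsBddBorel f) :
    ∃ T : H →L[ℂ] H, ∀ (ψ : H) (g : C(A.spec, ℝ)),
      ‖T ψ - A.contFun g ψ‖ = l2Dist (A.specMeasure ψ) f g := by
  choose T hT using A.exists_vec hf
  obtain ⟨C, hC⟩ := hf.bounded
  have hz : ∀ x : H, (∀ ε : ℝ, 0 < ε → ‖x‖ ≤ 3 * ε) → x = 0 := by
    intro x hx
    rw [← norm_le_zero_iff]
    refine le_of_forall_pos_le_add fun ε hε => ?_
    have := hx (ε / 3) (by positivity)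
    linarith
  have hadd : ∀ ψ φ, T (ψ + φ) = T ψ + T φ := by
    intro ψ φ
    rw [← sub_eq_zero]
    refine hz _ fun ε hε => ?_
    obtain ⟨g, h1, h2, h3⟩ := A.exists_cont_approx_three hf ψ φ (ψ + φ) hε
    rw [← hT] at h1 h2 h3
    have : T (ψ + φ) - (T ψ + T φ) = (T (ψ + φ) - A.contFun g (ψ + φ)) -
        (T ψ - A.contFun g ψ) - (T φ - A.contFun g φ) := by
      rw [map_add]; abel
    rw [this]
    have a1 := norm_sub_le ((T (ψ + φ) - A.contFun g (ψ + φ)) -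
        (T ψ - A.contFun g ψ)) (T φ - A.contFun g φ)
    have a2 := norm_sub_le (T (ψ + φ) - A.contFun g (ψ + φ)) (T ψ - A.contFun g ψ)
    linarith
  have hsmul : ∀ (c : ℂ) ψ, T (c • ψ) = c • T ψ := by
    intro c ψ
    rw [← sub_eq_zero, ← norm_le_zero_iff]
    refine le_of_forall_pos_le_add fun ε hε => ?_
    have hc : 0 < 1 + ‖c‖ := by positivity
    obtain ⟨g, h1, h2, -⟩ := A.exists_cont_approx_three hf ψ (c • ψ) 0
      (show 0 < ε / (1 + ‖c‖) by positivity)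
    rw [← hT] at h1 h2
    have : T (c • ψ) - c • T ψ = (T (c • ψ) - A.contFun g (c • ψ)) -
        c • (T ψ - A.contFun g ψ) := by
      rw [map_smul, smul_sub]; abel
    rw [this]
    have a1 := norm_sub_le (T (c • ψ) - A.contFun g (c • ψ)) (c • (T ψ - A.contFun g ψ))
    rw [norm_smul] at a1
    have a2 := mul_le_mul_of_nonneg_left h1 (norm_nonneg c)
    have a3 : (1 + ‖c‖) * (ε / (1 + ‖c‖)) = ε := by field_simp
    linarith
  have hbd : ∀ ψ, ‖T ψ‖ ≤ |C| * ‖ψ‖ := by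
    intro ψ
    have h0 : A.contFun 0 = 0 := map_zero (cfcHom A.isSelfAdjoint)
    have h := hT ψ 0
    rw [h0, zero_apply, sub_zero] at h
    rw [h]
    refine Real.sqrt_le_iff.2 ⟨by positivity, ?_⟩
    rw [mul_pow, ← A.specMeasure_univ ψ, sq_abs]
    have : ∫ x, (f x - (0 : C(A.spec, ℝ)) x) ^ 2 ∂(A.specMeasure ψ) ≤
        ∫ _, C ^ 2 ∂(A.specMeasure ψ) := by
      refine integral_mono_of_nonneg (Filter.Eventually.of_forall fun x => sq_nonneg _)
        (integrable_const _) (Filter.Eventually.of_forall fun x => ?_)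
      simpa using sq_le_sq.2 ((hC x).trans (le_abs_self C))
    simpa [mul_comm] using this
  exact ⟨LinearMap.mkContinuous ⟨⟨T, hadd⟩, hsmul⟩ |C| hbd, hT⟩

theorem inner_eq_integral_of_dist (A : Observable H) {f : A.spec → ℝ} (hf : IsBddBorel f)
    {T : H →L[ℂ] H} (hT : ∀ (ψ : H) (g : C(A.spec, ℝ)),
      ‖T ψ - A.contFun g ψ‖ = l2Dist (A.specMeasure ψ) f g) (ψ : H) :
    ⟪ψ, T ψ⟫_ℂ = ((∫ x, f x ∂(A.specMeasure ψ) : ℝ) : ℂ) := by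
  apply Complex.ext
  · have h0 := hT ψ 0
    have h1 := hT ψ 1
    have e0 : A.contFun 0 = 0 := map_zero (cfcHom A.isSelfAdjoint)
    have e1 : A.contFun 1 = 1 := map_one (cfcHom A.isSelfAdjoint)
    rw [e0, zero_apply, sub_zero] at h0
    rw [e1, one_apply_eq_self] at h1
    have h0' : ‖T ψ‖ ^ 2 = ∫ x, f x ^ 2 ∂(A.specMeasure ψ) := by
      rw [h0, l2Dist_sq]; simp
    have h1' : ‖T ψ - ψ‖ ^ 2 = ∫ x, (f x - 1) ^ 2 ∂(A.specMeasure ψ) := by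
      rw [h1, l2Dist_sq]; simp
    rw [@norm_sub_sq ℂ] at h1'
    have h1c : IsBddBorel fun _ : A.spec => (1 : ℝ) := ⟨measurable_const, 1, fun _ => by simp⟩
    have e := integral_sub_sq hf h1c (A.specMeasure ψ)
    have e2 : ∫ _, (1 : ℝ) ^ 2 ∂(A.specMeasure ψ) = ‖ψ‖ ^ 2 := by
      rw [← A.specMeasure_univ ψ]; simp
    rw [e2] at e
    simp only [mul_one] at e
    have hre : RCLike.re ⟪T ψ, ψ⟫_ℂ = (⟪ψ, T ψ⟫_ℂ).re := inner_re_symm (𝕜 := ℂ) _ _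
    rw [hre] at h1'
    simp only [Complex.ofReal_re]
    linarith
  · simp only [Complex.ofReal_im]
    rw [← abs_nonpos_iff]
    refine le_of_forall_pos_le_add fun ε hε => ?_
    obtain ⟨g, h1, -, -⟩ := A.exists_cont_approx_three hf ψ 0 0
      (show 0 < ε / (1 + ‖ψ‖) by positivity)
    rw [← hT] at h1
    have hg : (⟪ψ, A.contFun g ψ⟫_ℂ).im = 0 := by
      have := inner_conj_symm (𝕜 := ℂ) ψ (A.contFun g ψ)
      rw [contFun_symm] at this
      exact Complex.conj_eq_iff_im.1 this
    have h2 : (⟪ψ, T ψ⟫_ℂ).im = (⟪ψ, T ψ - A.contFun g ψ⟫_ℂ).im := by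
      rw [inner_sub_right, Complex.sub_im, hg, sub_zero]
    rw [h2]
    refine (Complex.abs_im_le_norm _).trans ((norm_inner_le_norm _ _).trans ?_)
    have a2 := mul_le_mul_of_nonneg_left h1 (norm_nonneg ψ)
    have a3 : (1 + ‖ψ‖) * (ε / (1 + ‖ψ‖)) = ε := by field_simp
    have a4 : 0 ≤ ε / (1 + ‖ψ‖) := by positivity
    linarith

theorem op_ext {S T : H →L[ℂ] H} (h : ∀ ψ, ⟪ψ, S ψ⟫_ℂ = ⟪ψ, T ψ⟫_ℂ) : S = T := by
  have h2 : (S : H →ₗ[ℂ] H) = T := by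
    rw [← ext_inner_map]
    intro x
    have := congrArg (starRingEnd ℂ) (h x)
    rwa [inner_conj_symm, inner_conj_symm] at this
  exact ContinuousLinearMap.coe_injective h2

/-- For every bounded Borel `f` there is exactly one bounded operator `T` with
`⟨ψ, T ψ⟩ = ∫ f d⟨ψ, E[A ∈ ·] ψ⟩` for all `ψ`. -/
theorem existsUnique_borelFun (A : Observable H) {f : A.spec → ℝ} (hf : IsBddBorel f) :
    ∃! T : H →L[ℂ] H, ∀ ψ : H, ⟪ψ, T ψ⟫_ℂ = ((∫ x, f x ∂(A.specMeasure ψ) : ℝ) : ℂ) := by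
  obtain ⟨T, hT⟩ := A.exists_op_aux hf
  exact ⟨T, A.inner_eq_integral_of_dist hf hT,
    fun S hS => op_ext fun ψ => (hS ψ).trans (A.inner_eq_integral_of_dist hf hT ψ).symm⟩

/-- The operator `f(A) = ∫ f(λ) dE^A_λ` for a bounded Borel function `f` on `σ(A)`. -/
noncomputable def borelFun (A : Observable H) (f : A.spec → ℝ) (hf : IsBddBorel f) : H →L[ℂ] H :=
  (A.existsUnique_borelFun hf).choose

theorem inner_borelFun (A : Observable H) {f : A.spec → ℝ} (hf : IsBddBorel f) (ψ : H) :
    ⟪ψ, A.borelFun f hf ψ⟫_ℂ = ((∫ x, f x ∂(A.specMeasure ψ) : ℝ) : ℂ) :=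
  (A.existsUnique_borelFun hf).choose_spec.1 ψ

theorem eq_borelFun (A : Observable H) {f : A.spec → ℝ} (hf : IsBddBorel f) {T : H →L[ℂ] H}
    (hT : ∀ ψ : H, ⟪ψ, T ψ⟫_ℂ = ((∫ x, f x ∂(A.specMeasure ψ) : ℝ) : ℂ)) :
    T = A.borelFun f hf := (A.existsUnique_borelFun hf).choose_spec.2 T hT

theorem norm_borelFun_sq (A : Observable H) {f : A.spec → ℝ} (hf : IsBddBorel f) (ψ : H) :
    ‖A.borelFun f hf ψ‖ ^ 2 = ∫ x, f x ^ 2 ∂(A.specMeasure ψ) := by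
  obtain ⟨T, hT⟩ := A.exists_op_aux hf
  rw [← A.eq_borelFun hf (A.inner_eq_integral_of_dist hf hT)]
  have h0 := hT ψ 0
  have e0 : A.contFun 0 = 0 := map_zero (cfcHom A.isSelfAdjoint)
  rw [e0, zero_apply, sub_zero] at h0
  rw [h0, l2Dist_sq]; simp

theorem isSelfAdjoint_of_inner {T : H →L[ℂ] H} (h : ∀ ψ, (⟪ψ, T ψ⟫_ℂ).im = 0) :
    IsSelfAdjoint T := by
  rw [ContinuousLinearMap.isSelfAdjoint_iff_isSymmetric,
    LinearMap.isSymmetric_iff_inner_map_self_real]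
  intro ψ
  rw [← inner_conj_symm, Complex.conj_conj]
  exact (Complex.conj_eq_iff_im.2 (h ψ)).symm

theorem borelFun_isSelfAdjoint (A : Observable H) {f : A.spec → ℝ} (hf : IsBddBorel f) :
    IsSelfAdjoint (A.borelFun f hf) :=
  isSelfAdjoint_of_inner fun ψ => by rw [inner_borelFun]; simp

theorem inner_symm_of_isSelfAdjoint {T : H →L[ℂ] H} (h : IsSelfAdjoint T) (φ ψ : H) :
    ⟪T φ, ψ⟫_ℂ = ⟪φ, T ψ⟫_ℂ := (ContinuousLinearMap.isSelfAdjoint_iff_isSymmetric.1 h) φ ψ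

theorem borelFun_sub (A : Observable H) {f g : A.spec → ℝ} (hf : IsBddBorel f)
    (hg : IsBddBorel g) :
    A.borelFun (fun x => f x - g x) (hf.sub hg) = A.borelFun f hf - A.borelFun g hg := by
  symm
  refine A.eq_borelFun _ fun ψ => ?_
  rw [sub_apply, inner_sub_right, inner_borelFun, inner_borelFun,
    integral_sub (hf.integrable _) (hg.integrable _), Complex.ofReal_sub]

theorem re_inner_borelFun (A : Observable H) {f g : A.spec → ℝ} (hf : IsBddBorel f)
    (hg : IsBddBorel g) (ψ : H) :
    (⟪A.borelFun f hf ψ, A.borelFun g hg ψ⟫_ℂ).re = ∫ x, f x * g x ∂(A.specMeasure ψ) := by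
  have h := A.norm_borelFun_sq (hf.sub hg) ψ
  rw [borelFun_sub, sub_apply, @norm_sub_sq ℂ, norm_borelFun_sq, norm_borelFun_sq] at h
  have e := integral_sub_sq hf hg (A.specMeasure ψ)
  change _ - 2 * (⟪A.borelFun f hf ψ, A.borelFun g hg ψ⟫_ℂ).re + _ = _ at h
  linarith

theorem borelFun_pow (A : Observable H) {f : A.spec → ℝ} (hf : IsBddBorel f) (k : ℕ) :
    A.borelFun (fun x => f x ^ k) (hf.pow k) = A.borelFun f hf ^ k := by
  symm
  induction k with
  | zero =>
    refine A.eq_borelFun _ fun ψ => ?_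
    simp [specMeasure_univ, inner_self_eq_norm_sq_to_K]
  | succ k ih =>
    refine A.eq_borelFun _ fun ψ => ?_
    have hsa : IsSelfAdjoint (A.borelFun f hf ^ (k + 1)) := (A.borelFun_isSelfAdjoint hf).pow _
    have him : (⟪ψ, (A.borelFun f hf ^ (k + 1)) ψ⟫_ℂ).im = 0 := by
      have := inner_conj_symm (𝕜 := ℂ) ψ ((A.borelFun f hf ^ (k + 1)) ψ)
      rw [inner_symm_of_isSelfAdjoint hsa] at this
      exact Complex.conj_eq_iff_im.1 this
    have hre := A.re_inner_borelFun hf (hf.pow k) ψ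
    rw [← ih, inner_symm_of_isSelfAdjoint (A.borelFun_isSelfAdjoint hf),
      ← mul_apply_eq_comp, ← pow_succ'] at hre
    apply Complex.ext
    · rw [hre, Complex.ofReal_re]
      simp_rw [pow_succ']
    · rw [him, Complex.ofReal_im]

theorem measure_ext_of_moments {μ ν : Measure ℝ} [IsFiniteMeasure μ] [IsFiniteMeasure ν] {M : ℝ}
    (hμ : ∀ᵐ x ∂μ, x ∈ Set.Icc (-M) M) (hν : ∀ᵐ x ∂ν, x ∈ Set.Icc (-M) M)
    (h : ∀ k : ℕ, ∫ x, x ^ k ∂μ = ∫ x, x ^ k ∂ν) : μ = ν := by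
  have hint : ∀ (κ : Measure ℝ) [IsFiniteMeasure κ], (∀ᵐ x ∂κ, x ∈ Set.Icc (-M) M) →
      ∀ g : ℝ → ℝ, Continuous g → Integrable g κ := by
    intro κ _ hκ g hg
    obtain ⟨C, hC⟩ := isCompact_Icc.exists_bound_of_continuousOn (hg.continuousOn (s := Set.Icc (-M) M))
    exact Integrable.of_bound hg.aestronglyMeasurable C (hκ.mono hC)
  have hpoly : ∀ p : Polynomial ℝ, ∫ x, p.eval x ∂μ = ∫ x, p.eval x ∂ν := by
    intro p
    simp_rw [Polynomial.eval_eq_sum_range]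
    rw [integral_finsetSum, integral_finsetSum]
    · simp_rw [integral_const_mul, h]
    · exact fun i _ => hint ν hν _ (by fun_prop)
    · exact fun i _ => hint μ hμ _ (by fun_prop)
  refine ext_of_forall_integral_eq_of_IsFiniteMeasure fun g => ?_
  have hclose : ∀ (κ : Measure ℝ) [IsFiniteMeasure κ], (∀ᵐ x ∂κ, x ∈ Set.Icc (-M) M) →
      ∀ (ε : ℝ) (p : Polynomial ℝ), (∀ x ∈ Set.Icc (-M) M, |p.eval x - g x| < ε) →
      |∫ x, p.eval x ∂κ - ∫ x, g x ∂κ| ≤ ε * κ.real Set.univ := by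
    intro κ _ hκ ε p hp
    rw [← integral_sub (hint κ hκ _ p.continuous) (hint κ hκ _ g.continuous)]
    have hb : ∀ᵐ x ∂κ, ‖p.eval x - g x‖ ≤ ε := hκ.mono fun x hx => (hp x hx).le
    exact norm_integral_le_of_norm_le_const hb
  rw [← sub_eq_zero, ← abs_nonpos_iff]
  refine le_of_forall_pos_le_add fun ε hε => ?_
  have hS : 0 < 1 + μ.real Set.univ + ν.real Set.univ := by positivity
  obtain ⟨p, hp⟩ := exists_polynomial_near_of_continuousOn (-M) M g g.continuous.continuousOn
    (ε / (1 + μ.real Set.univ + ν.real Set.univ)) (by positivity)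
  have h1 := abs_le.1 (hclose μ hμ _ p hp)
  have h2 := abs_le.1 (hclose ν hν _ p hp)
  have h3 := hpoly p
  have h4 : (1 + μ.real Set.univ + ν.real Set.univ) *
    (ε / (1 + μ.real Set.univ + ν.real Set.univ)) = ε := by field_simp
  have h5 : 0 < ε / (1 + μ.real Set.univ + ν.real Set.univ) := by positivity
  rw [abs_le]
  constructor <;> linarith

theorem measurableEmbedding_spec (A : Observable H) :
    MeasurableEmbedding (Subtype.val : A.spec → ℝ) :=
  MeasurableEmbedding.subtype_coe (spectrum.isClosed A.op).measurableSet

/-- If `B = f(A)`, the spectral measures of `B` are the images under `f` of those of `A`. -/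
theorem map_specMeasure {A B : Observable H} {f : A.spec → ℝ} (hf : IsBddBorel f)
    (h : B.op = A.borelFun f hf) (ψ : H) :
    (B.specMeasure ψ).map Subtype.val = (A.specMeasure ψ).map f := by
  have _ : IsFiniteMeasure ((B.specMeasure ψ).map Subtype.val) := inferInstance
  have _ : IsFiniteMeasure ((A.specMeasure ψ).map f) := inferInstance
  obtain ⟨C, hC⟩ := hf.bounded
  obtain ⟨D, hD⟩ := (spectrum.isCompact (𝕜 := ℝ) B.op).isBounded.exists_norm_le
  refine measure_ext_of_moments (M := max C D) ?_ ?_ fun k => ?_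
  · refine (ae_map_iff measurable_subtype_coe.aemeasurable measurableSet_Icc).2 ?_
    exact Filter.Eventually.of_forall fun x => abs_le.1 ((hD x x.2).trans (le_max_right _ _))
  · refine (ae_map_iff hf.measurable.aemeasurable measurableSet_Icc).2 ?_
    exact Filter.Eventually.of_forall fun x => abs_le.1 ((hC x).trans (le_max_left _ _))
  · rw [integral_map measurable_subtype_coe.aemeasurable (by fun_prop),
      integral_map hf.measurable.aemeasurable (by fun_prop)]
    have h1 := A.inner_borelFun (hf.pow k) ψ
    rw [A.borelFun_pow hf, ← h] at h1
    have h2 := B.integral_specMeasure ψ (((ContinuousMap.id ℝ).restrict B.spec) ^ k)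
    have h3 : B.contFun (((ContinuousMap.id ℝ).restrict B.spec) ^ k) = B.op ^ k := by
      rw [contFun, map_pow, cfcHom_id]
    rw [h3, h1] at h2
    simpa using h2

/-- The pre-order on the bounded observables: `B ≤ A` if `B = f(A)` for a bounded Borel
function `f : σ(A) → ℝ`. -/
instance : LE (Observable H) :=
  ⟨fun B A => ∃ (f : A.spec → ℝ) (hf : IsBddBorel f), B.op = A.borelFun f hf⟩

theorem isBddBorel_coe (A : Observable H) : IsBddBorel (fun x : A.spec => (x : ℝ)) := by
  obtain ⟨D, hD⟩ := (spectrum.isCompact (𝕜 := ℝ) A.op).isBounded.exists_norm_le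
  exact ⟨measurable_subtype_coe, D, fun x => hD x x.2⟩

/-- The spectral representation `A = ∫ λ dE^A_λ`. -/
theorem op_eq_borelFun (A : Observable H) : A.op = A.borelFun _ A.isBddBorel_coe := by
  refine A.eq_borelFun _ fun ψ => ?_
  have h2 := A.integral_specMeasure ψ ((ContinuousMap.id ℝ).restrict A.spec)
  have h3 : A.contFun ((ContinuousMap.id ℝ).restrict A.spec) = A.op := by
    rw [contFun, cfcHom_id]
  rw [h3] at h2
  apply Complex.ext
  · rw [← h2, Complex.ofReal_re]
    rfl
  · have := inner_conj_symm (𝕜 := ℂ) ψ (A.op ψ)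
    rw [inner_symm_of_isSelfAdjoint A.isSelfAdjoint] at this
    rw [Complex.conj_eq_iff_im.1 this, Complex.ofReal_im]

theorem le_trans_aux {A B C : Observable H} (h₁ : C ≤ B) (h₂ : B ≤ A) : C ≤ A := by
  obtain ⟨h, hh, hC⟩ := h₁
  obtain ⟨f, hf, hB⟩ := h₂
  have hext : IsBddBorel (Function.extend Subtype.val h (fun _ => 0)) := by
    obtain ⟨D, hD⟩ := hh.bounded
    refine ⟨B.measurableEmbedding_spec.measurable_extend hh.measurable measurable_const,
      max D 0, fun x => ?_⟩
    by_cases hx : ∃ y : B.spec, (y : ℝ) = x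
    · obtain ⟨y, rfl⟩ := hx
      rw [Subtype.val_injective.extend_apply]
      exact (hD y).trans (le_max_left _ _)
    · rw [Function.extend_apply' _ _ _ hx]
      simp
  refine ⟨fun x => Function.extend Subtype.val h (fun _ => 0) (f x),
    ⟨hext.measurable.comp hf.measurable, ?_⟩, ?_⟩
  · obtain ⟨D, hD⟩ := hext.bounded
    exact ⟨D, fun x => hD _⟩
  · refine A.eq_borelFun _ fun ψ => ?_
    rw [hC, inner_borelFun, ← integral_map hf.measurable.aemeasurable
      hext.measurable.aestronglyMeasurable, ← map_specMeasure hf hB,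
      B.measurableEmbedding_spec.integral_map]
    simp_rw [Subtype.val_injective.extend_apply]

/-- The bounded observables form a pre-ordered set, hence a category `𝒪` in which there is at
most one morphism `B ⟶ A`, and there is one precisely if `B = f(A)` for some `f`. -/
instance : Preorder (Observable H) where
  le_refl A := ⟨_, A.isBddBorel_coe, A.op_eq_borelFun⟩
  le_trans _ _ _ h₁ h₂ := le_trans_aux h₁ h₂

end Observable

/-- The projection operators on `H`, with the order induced by the order of operators. -/
abbrev Projector (H : Type*) [NormedAddCommGroup H] [InnerProductSpace ℂ H] [CompleteSpace H] :=
  {p : H →L[ℂ] H // IsStarProjection p}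

namespace Projector

/-- The vectors fixed by all projectors of a set, i.e. the intersection of their ranges. -/
def fixed (S : Set (Projector H)) : Submodule ℂ H :=
  ⨅ Q ∈ S, (1 - Q.1 : H →L[ℂ] H).ker

theorem mem_fixed {S : Set (Projector H)} {x : H} : x ∈ fixed S ↔ ∀ Q ∈ S, Q.1 x = x := by
  simp only [fixed, Submodule.mem_iInf]
  refine forall₂_congr fun Q _ => ?_
  change (1 - Q.1 : H →L[ℂ] H) x = 0 ↔ _
  rw [sub_apply, one_apply_eq_self, sub_eq_zero, eq_comm]

theorem isClosed_fixed (S : Set (Projector H)) : IsClosed (fixed S : Set H) := by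
  have : (fixed S : Set H) = ⋂ Q ∈ S, {x | Q.1 x = x} := by
    ext x
    simp [mem_fixed]
  rw [this]
  exact isClosed_biInter fun Q _ => isClosed_eq Q.1.continuous continuous_id

instance (S : Set (Projector H)) : CompleteSpace (fixed S) :=
  (isClosed_fixed S).completeSpace_coe

/-- The infimum of a set of projectors in the lattice of projectors: the orthogonal projection
onto the intersection of their ranges. -/
noncomputable def inf (S : Set (Projector H)) : Projector H :=
  ⟨(fixed S).starProjection, isStarProjection_starProjection⟩

theorem le_iff {P Q : Projector H} : P ≤ Q ↔ ∀ x, Q.1 (P.1 x) = P.1 x := by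
  change P.1 ≤ Q.1 ↔ _
  rw [P.2.le_iff_mul_eq_right Q.2, ContinuousLinearMap.ext_iff]
  rfl

theorem isGLB_inf (S : Set (Projector H)) : IsGLB S (inf S) := by
  constructor
  · intro Q hQ
    rw [le_iff]
    intro x
    exact mem_fixed.1 ((fixed S).starProjection_apply_mem x) Q hQ
  · intro R hR
    rw [le_iff]
    intro x
    refine Submodule.starProjection_eq_self_iff.2 (mem_fixed.2 fun Q hQ => ?_)
    exact le_iff.1 (hR hQ) x

end Projector

namespace Observable

theorem isBddBorel_indicator {X : Type*} [MeasurableSpace X] {Δ : Set X} (hΔ : MeasurableSet Δ) :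
    IsBddBorel (Δ.indicator fun _ => (1 : ℝ)) :=
  ⟨measurable_const.indicator hΔ, 1, fun x => by by_cases h : x ∈ Δ <;> simp [h]⟩

/-- The spectral projector `E[A ∈ Δ] = χ_Δ(A)`, for a Borel set `Δ ⊆ σ(A)`. -/
noncomputable def specProj (A : Observable H) (Δ : Set A.spec) (hΔ : MeasurableSet Δ) :
    Projector H :=
  ⟨A.borelFun (Δ.indicator fun _ => 1) (isBddBorel_indicator hΔ), by
    refine ⟨?_, A.borelFun_isSelfAdjoint _⟩
    rw [IsIdempotentElem, ← sq, ← borelFun_pow]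
    congr 1
    ext x
    by_cases h : x ∈ Δ <;> simp [h]⟩

theorem inner_specProj (A : Observable H) {Δ : Set A.spec} (hΔ : MeasurableSet Δ) (ψ : H) :
    ⟪ψ, (A.specProj Δ hΔ).1 ψ⟫_ℂ = (((A.specMeasure ψ).real Δ : ℝ) : ℂ) := by
  rw [specProj, inner_borelFun, integral_indicator_const _ hΔ]
  simp

/-- The projector `E[B ∈ f(Δ)]` for `B = f(A)`: the infimum of all spectral projectors
`E[B ∈ K]`, `K ⊆ σ(B)` Borel, that satisfy `E[A ∈ Δ] ≤ E[B ∈ K]`. It depends on `f` only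
through the operator `B = f(A)`. -/
noncomputable def imageProj (A : Observable H) (Δ : Set A.spec) (hΔ : MeasurableSet Δ)
    (B : Observable H) : Projector H :=
  Projector.inf {Q | ∃ (K : Set B.spec) (hK : MeasurableSet K),
    Q = B.specProj K hK ∧ A.specProj Δ hΔ ≤ B.specProj K hK}

theorem exists_specProj_eq {B C : Observable H} (h : C ≤ B) (K : Set C.spec)
    (hK : MeasurableSet K) : ∃ (L : Set B.spec) (hL : MeasurableSet L),
      C.specProj K hK = B.specProj L hL := by
  obtain ⟨f, hf, hC⟩ := h
  have hK' : MeasurableSet (Subtype.val '' K : Set ℝ) :=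
    C.measurableEmbedding_spec.measurableSet_image.2 hK
  refine ⟨f ⁻¹' (Subtype.val '' K), hf.measurable hK', Subtype.ext (op_ext fun ψ => ?_)⟩
  rw [inner_specProj, inner_specProj, Measure.real, Measure.real,
    ← Measure.map_apply hf.measurable hK', ← map_specMeasure hf hC,
    C.measurableEmbedding_spec.map_apply, Subtype.val_injective.preimage_image]

theorem imageProj_mono (A : Observable H) {Δ : Set A.spec} (hΔ : MeasurableSet Δ)
    {B C : Observable H} (h : C ≤ B) : A.imageProj Δ hΔ B ≤ A.imageProj Δ hΔ C := by
  refine (Projector.isGLB_inf _).2 ?_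
  rintro Q ⟨K, hK, rfl, hQ⟩
  obtain ⟨L, hL, e⟩ := exists_specProj_eq h K hK
  exact (Projector.isGLB_inf _).1 ⟨L, hL, e, e ▸ hQ⟩

end Observable

/-- `T` has trace `t`: the diagonal sums of `T` converge unconditionally to `t` in every
orthonormal basis. -/
def HasTrace (T : H →L[ℂ] H) (t : ℂ) : Prop :=
  ∀ (w : Set H) (b : HilbertBasis w ℂ H), HasSum (fun i => ⟪b i, T (b i)⟫_ℂ) t

/-- Density matrices: positive operators of trace one. -/
structure IsDensityMatrix (ρ : H →L[ℂ] H) : Prop where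
  isPositive : ρ.IsPositive
  trace_eq_one : HasTrace ρ 1

theorem exists_adapted_basis (E : Projector H) :
    ∃ (w : Set H) (b : HilbertBasis w ℂ H), ∀ i, E.1 (b i) = b i ∨ E.1 (b i) = 0 := by
  set K : Submodule ℂ H := E.1.ker
  have : CompleteSpace K := E.1.isClosed_ker.completeSpace_coe
  obtain ⟨s, c, hc⟩ := exists_hilbertBasis ℂ K
  have ho : Orthonormal ℂ (fun i : s => ((c i : K) : H)) :=
    c.orthonormal.comp_linearIsometry K.subtypeₗᵢ
  obtain ⟨w, b, hw, hb⟩ := ho.toSubtypeRange.exists_hilbertBasis_extension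
  refine ⟨w, b, fun i => ?_⟩
  by_cases hi : (i : H) ∈ Set.range (fun i : s => ((c i : K) : H))
  · right
    obtain ⟨j, hj⟩ := hi
    rw [hb]
    rw [← hj]
    exact (c j).2
  · left
    have horth : ∀ x ∈ K, ⟪x, b i⟫_ℂ = 0 := by
      intro x hx
      have hd := c.dense_span
      have hcl : IsClosed {y : K | ⟪(y : H), b i⟫_ℂ = 0} :=
        isClosed_eq (by fun_prop) continuous_const
      have hsub : (Submodule.span ℂ (Set.range c)).topologicalClosure ≤
          ((innerSL ℂ (b i)).comp K.subtypeL).ker := by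
        refine Submodule.topologicalClosure_minimal _ ?_ (ContinuousLinearMap.isClosed_ker _)
        rw [Submodule.span_le]
        rintro _ ⟨j, rfl⟩
        change ⟪b i, ((c j : K) : H)⟫_ℂ = 0
        have hjw : ((c j : K) : H) ∈ w := hw ⟨j, rfl⟩
        have hj : b ⟨_, hjw⟩ = ((c j : K) : H) := by rw [hb]
        rw [← hj]
        refine b.orthonormal.2 fun e => hi ⟨j, ?_⟩
        rw [e]
      have hx' : (⟨x, hx⟩ : K) ∈ ((innerSL ℂ (b i)).comp K.subtypeL).ker :=
        hsub (hd ▸ Submodule.mem_top)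
      have hx'' : ⟪b i, x⟫_ℂ = 0 := hx'
      rw [← inner_conj_symm, hx'', map_zero]
    have hmem : b i - E.1 (b i) ∈ K := by
      change E.1 (b i - E.1 (b i)) = 0
      have : E.1 (E.1 (b i)) = E.1 (b i) := congrArg (fun T : H →L[ℂ] H => T (b i)) E.2.1
      rw [map_sub, this, sub_self]
    have h0 := horth _ hmem
    have h1 : ⟪b i - E.1 (b i), E.1 (b i)⟫_ℂ = 0 := by
      rw [← Observable.inner_symm_of_isSelfAdjoint E.2.2]
      have : E.1 (b i - E.1 (b i)) = 0 := hmem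
      rw [this, inner_zero_left]
    have h2 : ⟪b i - E.1 (b i), b i - E.1 (b i)⟫_ℂ = 0 := by
      rw [inner_sub_right, h0, h1, sub_zero]
    exact (sub_eq_zero.1 (inner_self_eq_zero.1 h2)).symm

/-- For a density matrix, `tr(ρ E) = 1` is inherited by larger projectors. -/
theorem IsDensityMatrix.hasTrace_mono {ρ : H →L[ℂ] H} (hρ : IsDensityMatrix ρ)
    {E F : Projector H} (hEF : E ≤ F) (hE : HasTrace (ρ * E.1) 1) : HasTrace (ρ * F.1) 1 := by
  have key : ρ * E.1 = ρ := by
    obtain ⟨w, b, hb⟩ := exists_adapted_basis E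
    have hs := (hρ.trace_eq_one w b).sub (hE w b)
    rw [sub_self] at hs
    have hker : ∀ x, (⟪x, ρ x⟫_ℂ).re = 0 → ρ x = 0 := by
      intro x hx
      obtain ⟨S, rfl⟩ := CStarAlgebra.nonneg_iff_eq_star_mul_self.1
        ((ContinuousLinearMap.nonneg_iff_isPositive ρ).2 hρ.isPositive)
      rw [mul_apply_eq_comp, ContinuousLinearMap.star_eq_adjoint,
        ContinuousLinearMap.adjoint_inner_right, inner_self_eq_norm_sq_to_K] at hx
      have hS : S x = 0 := by simpa [← Complex.ofReal_pow] using hx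
      rw [mul_apply_eq_comp, hS, map_zero]
    have hterm : ∀ i, ρ (b i) = ρ (E.1 (b i)) := by
      have hnn : ∀ i, 0 ≤ (⟪b i, ρ (b i)⟫_ℂ - ⟪b i, (ρ * E.1) (b i)⟫_ℂ).re := by
        intro i
        rw [mul_apply_eq_comp]
        rcases hb i with h | h
        · rw [h, sub_self]; rfl
        · rw [h, map_zero, inner_zero_right, sub_zero]
          exact hρ.isPositive.re_inner_nonneg_right (b i)
      have hs' := Complex.hasSum_re hs
      rw [Complex.zero_re] at hs'
      have hz := (hasSum_zero_iff_of_nonneg hnn).1 hs'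
      intro i
      rcases hb i with h | h
      · rw [h]
      · have := congrFun hz i
        simp only [Pi.zero_apply, mul_apply_eq_comp, h, map_zero, inner_zero_right,
          sub_zero] at this
        rw [h, map_zero]
        exact hker _ this
    have hd : ∀ x, (ρ - ρ * E.1 : H →L[ℂ] H) x = 0 := by
      intro x
      have hsub : (Submodule.span ℂ (Set.range b)).topologicalClosure ≤
          (ρ - ρ * E.1 : H →L[ℂ] H).ker := by
        refine Submodule.topologicalClosure_minimal _ ?_ (ContinuousLinearMap.isClosed_ker _)
        rw [Submodule.span_le]
        rintro _ ⟨j, rfl⟩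
        change (ρ - ρ * E.1 : H →L[ℂ] H) (b j) = 0
        rw [sub_apply, mul_apply_eq_comp, hterm j, sub_self]
      exact hsub (b.dense_span ▸ Submodule.mem_top)
    exact (sub_eq_zero.1 (ContinuousLinearMap.ext hd)).symm
  have h2 : ρ * F.1 = ρ := by
    have h3 : E.1 * F.1 = E.1 := (E.2.le_iff_mul_eq_left F.2).1 hEF
    rw [← key, mul_assoc, h3]
  rw [h2]
  exact hρ.trace_eq_one

open CategoryTheory

/-- The valuation `ν^P(A ∈ Δ) = {f : B ⟶ A | P ≤ E[B ∈ f(Δ)]}`, a sieve on `A` in `𝒪`. -/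
noncomputable def projectorValuation (P : Projector H) (A : Observable H) (Δ : Set A.spec)
    (hΔ : MeasurableSet Δ) : Sieve A where
  arrows B := {_f : B ⟶ A | P ≤ A.imageProj Δ hΔ B}
  downward_closed hf g := le_trans hf (A.imageProj_mono hΔ (leOfHom g))

/-- The valuation `ν^ρ(A ∈ Δ) = {f : B ⟶ A | tr(ρ E[B ∈ f(Δ)]) = 1}` of a density matrix `ρ`,
a sieve on `A` in `𝒪`. -/
noncomputable def densityValuation (ρ : H →L[ℂ] H) (hρ : IsDensityMatrix ρ) (A : Observable H)
    (Δ : Set A.spec) (hΔ : MeasurableSet Δ) : Sieve A where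
  arrows B := {_f : B ⟶ A | HasTrace (ρ * (A.imageProj Δ hΔ B).1) 1}
  downward_closed hf g := hρ.hasTrace_mono (A.imageProj_mono hΔ (leOfHom g)) hf

end

end QuantumValuation

namespace QuantumValuation

open scoped InnerProductSpace

variable {H : Type*} [NormedAddCommGroup H] [InnerProductSpace ℂ H] [CompleteSpace H]

/-! ### Traces of projectors and the order of projectors. -/

namespace Projector

/-! The spectral theory plays no part beyond the fact that `E[B ∈ f(Δ)]` is a projector. Membership
of an arrow in either sieve is a condition on this one projector Q, so it suffices that, for every
projector Q, P ≤ Q if and only if tr(n⁻¹ P Q) = 1.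

If P ≤ Q, then PQ = P, and the trace is that of n⁻¹P, which is 1 because tr P is the dimension of
the range (`hasTrace_finrank`). Conversely, tr(n⁻¹ P Q) = 1 says tr(PQ) = n = tr P. Compute both
traces in an orthonormal basis (bᵢ) each of whose vectors is fixed or annihilated by Q. The
difference tr P − tr(PQ) is then the sum of ‖P bᵢ‖² over the annihilated vectors. A vanishing sum of
nonnegative terms has only zero terms, so P kills every bᵢ that Q kills. Hence P and PQ agree on the
basis, so P = PQ, which is P ≤ Q (`le_of_hasTrace_mul`).

Since `HasTrace` quantifies over all orthonormal bases, it lets this argument choose the adapted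
basis, but it obliges the computation of tr P to work in every basis. -/

theorem apply_apply (P : Projector H) (x : H) : P.1 (P.1 x) = P.1 x :=
  congrArg (fun T : H →L[ℂ] H => T x) P.2.1

/-- Idempotence and self-adjointness give ⟨x, Px⟩ = ⟨x, PPx⟩ = ⟨Px, Px⟩. This is the source of the
nonnegativity of the diagonal terms in the trace comparison. -/
theorem inner_apply_self (P : Projector H) (x : H) : ⟪x, P.1 x⟫_ℂ = ((‖P.1 x‖ ^ 2 : ℝ) : ℂ) := by
  rw [← P.apply_apply x, ← Observable.inner_symm_of_isSelfAdjoint P.2.2, P.apply_apply,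
    inner_self_eq_norm_sq_to_K]
  simp

/-- The trace of a projector of finite rank is the dimension of its range. -/
theorem hasTrace_finrank (P : Projector H) [FiniteDimensional ℂ P.1.range] :
    HasTrace P.1 (Module.finrank ℂ P.1.range : ℂ) := by
  intro w b
  set e := stdOrthonormalBasis ℂ P.1.range
  have hfix : ∀ j, P.1 (e j : H) = e j := by
    intro j
    obtain ⟨y, hy⟩ := (e j).2
    rw [← hy]
    exact P.apply_apply y
  -- Expand Px in the orthonormal basis e of the range. The coefficient ⟨eⱼ, Px⟩ equals ⟨Peⱼ, x⟩ =
  -- ⟨eⱼ, x⟩, so P disappears from the right-hand side.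
  have hexp : ∀ x : H, ⟪x, P.1 x⟫_ℂ = ∑ j, ⟪(e j : H), x⟫_ℂ * ⟪x, (e j : H)⟫_ℂ := by
    intro x
    have h := congrArg (fun v : P.1.range => ⟪x, (v : H)⟫_ℂ) (e.sum_repr' ⟨P.1 x, x, rfl⟩)
    simp only [Submodule.coe_sum, Submodule.coe_smul, Submodule.coe_inner, inner_sum,
      inner_smul_right] at h
    rw [← h]
    refine Finset.sum_congr rfl fun j _ => ?_
    rw [← Observable.inner_symm_of_isSelfAdjoint P.2.2, hfix]
  -- The sum over j is finite, so it may be interchanged with the sum over i. For each fixed j,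
  -- Parseval's identity in b gives ⟨eⱼ, eⱼ⟩, whatever the basis b is.
  have hs : HasSum (fun i => ∑ j, ⟪(e j : H), b i⟫_ℂ * ⟪b i, (e j : H)⟫_ℂ)
      (∑ j, ⟪(e j : H), (e j : H)⟫_ℂ) :=
    hasSum_sum fun j _ => b.hasSum_inner_mul_inner (e j : H) (e j : H)
  have hone : ∀ j, ⟪(e j : H), (e j : H)⟫_ℂ = 1 := by
    intro j
    rw [← Submodule.coe_inner, inner_self_eq_norm_sq_to_K, e.orthonormal.1 j]
    simp
  simp only [hone, Finset.sum_const, Finset.card_univ, Fintype.card_fin, nsmul_one] at hs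
  simpa only [hexp] using hs

/-- A projector `P` with `tr (P Q) = tr P < ∞` lies below `Q`. -/
theorem le_of_hasTrace_mul {P Q : Projector H} {t : ℂ} (hP : HasTrace P.1 t)
    (hPQ : HasTrace (P.1 * Q.1) t) : P ≤ Q := by
  obtain ⟨w, b, hb⟩ := exists_adapted_basis Q
  -- Both traces are the same number t, so the termwise differences sum to 0. Real parts are taken
  -- to reach a series of nonnegative reals.
  have hs := Complex.hasSum_re ((hP w b).sub (hPQ w b))
  rw [sub_self, Complex.zero_re] at hs
  have hker : ∀ i, Q.1 (b i) = 0 →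
      (⟪b i, P.1 (b i)⟫_ℂ - ⟪b i, (P.1 * Q.1) (b i)⟫_ℂ).re = ‖P.1 (b i)‖ ^ 2 := by
    intro i h
    rw [mul_apply_eq_comp, h, map_zero, inner_zero_right, sub_zero, P.inner_apply_self,
      Complex.ofReal_re]
  -- A basis vector fixed by Q contributes 0; one annihilated by Q contributes ‖P bᵢ‖².
  have hnn : ∀ i, 0 ≤ (⟪b i, P.1 (b i)⟫_ℂ - ⟪b i, (P.1 * Q.1) (b i)⟫_ℂ).re := by
    intro i
    rcases hb i with h | h
    · rw [mul_apply_eq_comp, h, sub_self, Complex.zero_re]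
    · rw [hker i h]
      positivity
  have hz := (hasSum_zero_iff_of_nonneg hnn).1 hs
  have hmul : P.1 = P.1 * Q.1 := by
    -- The span of b is dense, so continuous operators that agree on b are equal. On vectors fixed
    -- by Q the agreement is immediate; on annihilated ones it is P bᵢ = 0, from the vanishing term.
    refine ContinuousLinearMap.ext_on
      (Submodule.dense_iff_topologicalClosure_eq_top.2 b.dense_span) ?_
    rintro _ ⟨i, rfl⟩
    rw [mul_apply_eq_comp]
    rcases hb i with h | h
    · rw [h]
    · have h0 : ‖P.1 (b i)‖ ^ 2 = 0 := (hker i h).symm.trans (congrFun hz i)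
      rw [h, map_zero, ← norm_eq_zero]
      exact pow_eq_zero_iff two_ne_zero |>.1 h0
  exact (P.2.le_iff_mul_eq_left Q.2).2 hmul.symm

end Projector

/-! ### Normalisation to a density matrix. -/

theorem HasTrace.smul {E : Type*} [NormedAddCommGroup E] [InnerProductSpace ℂ E]
    {T : E →L[ℂ] E} {t : ℂ} (h : HasTrace T t) (c : ℂ) :
    HasTrace (c • T) (c * t) := by
  intro w b
  simpa [inner_smul_right] using (h w b).mul_left c

/-- A projector of finite rank `n ≥ 1`, divided by `n`, is a density matrix. -/
theorem isDensityMatrix_inv_smul (P : Projector H) {n : ℕ} (hn : 0 < n)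
    (hP : HasTrace P.1 n) : IsDensityMatrix ((n : ℂ)⁻¹ • P.1) where
  isPositive := by
    rw [← ContinuousLinearMap.nonneg_iff_isPositive]
    -- Positivity of a scalar multiple is taken from the ordered action of ℝ on operators, so the
    -- complex scalar is first replaced by the real one.
    have hc : (n : ℂ)⁻¹ • P.1 = (n : ℝ)⁻¹ • P.1 := by
      ext x
      simp [← Complex.coe_smul]
    rw [hc]
    exact smul_nonneg (by positivity) P.2.nonneg
  trace_eq_one := by
    have h := hP.smul (n : ℂ)⁻¹
    rwa [inv_mul_cancel₀ (Nat.cast_ne_zero.2 hn.ne')] at h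

end QuantumValuation

/-! ### Equality of the two sieves. -/

/-- The first claim appears as an existential because `densityValuation` takes the proof that its
operator is a density matrix as an argument: downward closure of the sieve rests on it. -/
theorem mainTheorem9 {H : Type*} [NormedAddCommGroup H] [InnerProductSpace ℂ H] [CompleteSpace H]
    (P : QuantumValuation.Projector H) (n : ℕ) (hn : 0 < n)
    (hfin : FiniteDimensional ℂ P.1.range) (hrank : Module.finrank ℂ P.1.range = n) :
    ∃ hρ : QuantumValuation.IsDensityMatrix ((n : ℂ)⁻¹ • P.1),
      ∀ (A : QuantumValuation.Observable H) (Δ : Set A.spec) (hΔ : MeasurableSet Δ),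
        QuantumValuation.projectorValuation P A Δ hΔ =
          QuantumValuation.densityValuation ((n : ℂ)⁻¹ • P.1) hρ A Δ hΔ := by
  have hP : QuantumValuation.HasTrace P.1 n := hrank ▸ P.hasTrace_finrank
  have hρ := QuantumValuation.isDensityMatrix_inv_smul P hn hP
  refine ⟨hρ, fun A Δ hΔ => CategoryTheory.Sieve.ext fun B f => ?_⟩
  -- The arrow f no longer occurs: both conditions see only its domain B.
  change P ≤ A.imageProj Δ hΔ B ↔
    QuantumValuation.HasTrace ((n : ℂ)⁻¹ • P.1 * (A.imageProj Δ hΔ B).1) 1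
  constructor
  · intro h
    rw [smul_mul_assoc, (P.2.le_iff_mul_eq_left (A.imageProj Δ hΔ B).2).1 h]
    exact hρ.trace_eq_one
  · intro h
    have hn' : (n : ℂ) ≠ 0 := Nat.cast_ne_zero.2 hn.ne'
    -- Multiplying by n undoes the normalisation and gives tr(PQ) = n, the value already known for
    -- tr P.
    have h' := h.smul (n : ℂ)
    rw [smul_mul_assoc, smul_inv_smul₀ hn', mul_one] at h'
    exact QuantumValuation.Projector.le_of_hasTrace_mul hP h'
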